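/- A (row-finite) weighted graph $(E,\omega)$ consists of countable sets $E^0$ (vertices) and $E^{\mathrm{st}}$ (structured edges), maps $s,r:E^{\mathrm{st}}\to E^0$ with every $s^{-1}(v)$ finite, and a weight map $\omega:E^{\mathrm{st}}\to\{1,2,3,\dots\}$; its edges are the symbols $\alpha_i$ with $\alpha\in E^{\mathrm{st}}$, $1\le i\le\omega(\alpha)$. For a vertex $v$ put $\omega(v)=\max\{\omega(\alpha): s(\alpha)=v\}$ ($0$ if $v$ emits no edge), and call $v$ weighted if $\omega(v)>1$. The weight forest $W\subseteq E^0$ is the set of all vertices that can be reached by a (possibly trivial) directed path from some weighted vertex. A weighted graph with at least one weighted vertex is called reducible if $|s^{-1}(v)|\le 1$ and $|r^{-1}(v)\cap s^{-1}(W)|\le 1$ for every $v\in W$, and irreducible otherwise. Let $R$ be a unital (not necessarily commutative) ring. The weighted Leavitt path algebra $L_R(E,\omega)$ is the quotient of the free (non-unital) $R$-ring on the symbols $v$ ($v\in E^0$), $\alpha_i$, $\alpha_i^*$ (elements of $R$ commuting with words) by the ideal generated by the relations 1. $vw=\delta_{vw}v$ for $v,w\in E^0$; 2. $s(\alpha)\alpha_i=\alpha_i=\alpha_i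 r(\alpha)$ and $r(\alpha)\alpha_i^*=\alpha_i^*=\alpha_i^*s(\alpha)$; 3. $\sum_{\alpha\in s^{-1}(v)}\alpha_i\alpha_j^*=\delta_{ij}v$ for $v\in E^0$, $1\le i,j\le\omega(v)$; 4. $\sum_{1\le i\le\max\{\omega(\alpha),\omega(\beta)\}}\alpha_i^*\beta_i=\delta_{\alpha\beta}\,r(\alpha)$ for $\alpha,\beta\in E^{\mathrm{st}}$, where $\alpha_i=\alpha_i^*=0$ in (3) and (4) if $i>\omega(\alpha)$. With $n=\sup_\alpha\omega(\alpha)$ it is graded by $\mathbb Z^n$ (by the direct sum of countably many copies of $\mathbb Z$ if $n=\infty$) via $\deg v=0$, $\deg\alpha_i=e_i$, $\deg\alpha_i^*=-e_i$. An ideal $J$ is called proper if $J\ne 0$ and $J\ne L_R(E,\omega)$; $L_R(E,\omega)$ is called graded simple if its multiplication is not identically zero and it has no proper graded two-sided ideal. **Proposition.** If $(E,\omega)$ is irreducible, then $L_R(E,\omega)$ is not graded simple; more precisely, if $R\neq 0$, then $L_R(E,\omega)$ has a proper graded ideal. -/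

import Mathlib

universe u v w

/-- A row-finite weighted graph: countable sets of vertices and of structured edges, source and
range maps, a weight map with positive integer values; every vertex emits finitely many
structured edges. The edges `α_1, …, α_{ω(α)}` are the pairs `(α, i)` with `i : Fin (ω α)`, so that
`α_{i+1}` is `(α, i)`: indices of edges start at `0` throughout. -/
structure WeightedGraph where
  Vert : Type u
  SEdge : Type v
  src : SEdge → Vert
  rng : SEdge → Vert
  weight : SEdge → ℕ
  weight_pos : ∀ α, 0 < weight α
  countable_vert : Countable Vert
  countable_sedge : Countable SEdge
  rowFinite : ∀ v, (src ⁻¹' {v}).Finite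

namespace WeightedGraph

/-- The finite set `s⁻¹(v)` of structured edges with source `v`. -/
noncomputable def out (E : WeightedGraph.{u, v}) (v : E.Vert) : Finset E.SEdge :=
  (E.rowFinite v).toFinset

/-- `ω(v)`, the maximal weight of a structured edge with source `v` (`0` if `v` is a sink). -/
noncomputable def vertWeight (E : WeightedGraph.{u, v}) (v : E.Vert) : ℕ :=
  (E.out v).sup E.weight

/-- The set of weighted vertices. -/
def weightedVerts (E : WeightedGraph.{u, v}) : Set E.Vert := {v | 1 < E.vertWeight v}

/-- `u ≥ v`: there is a (possibly trivial) path from `u` to `v`. -/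
def Reaches (E : WeightedGraph.{u, v}) : E.Vert → E.Vert → Prop :=
  Relation.ReflTransGen fun u v => ∃ α, E.src α = u ∧ E.rng α = v

/-- The tree `T(u)` of a vertex. -/
def tree (E : WeightedGraph.{u, v}) (u : E.Vert) : Set E.Vert := {v | E.Reaches u v}

/-- The weight forest: the union of the trees of the weighted vertices. -/
def weightForest (E : WeightedGraph.{u, v}) : Set E.Vert := ⋃ u ∈ E.weightedVerts, E.tree u

/-- The local condition in the definition of reducibility: every vertex of the weight forest emits
at most one structured edge, and receives at most one from the weight forest. -/
def ForestCondition (E : WeightedGraph.{u, v}) : Prop :=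
  ∀ v ∈ E.weightForest, (E.src ⁻¹' {v}).encard ≤ 1 ∧
    (E.rng ⁻¹' {v} ∩ E.src ⁻¹' E.weightForest).encard ≤ 1

/-- Reducible weighted graphs. -/
def IsReducible (E : WeightedGraph.{u, v}) : Prop := E.weightedVerts.Nonempty ∧ E.ForestCondition

/-- Irreducible weighted graphs: those with a weighted vertex that are not reducible. -/
def IsIrreducible (E : WeightedGraph.{u, v}) : Prop := E.weightedVerts.Nonempty ∧ ¬ E.IsReducible

/-- The generators `X = E⁰ ∪ E¹ ∪ (E¹)^*`. -/
inductive Gen (E : WeightedGraph.{u, v})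
  | vert (v : E.Vert)
  | edge (α : E.SEdge) (i : Fin (E.weight α))
  | ghost (α : E.SEdge) (i : Fin (E.weight α))

/-- The free `R`-ring `R⟨X⟩` (without unit): the free left `R`-module on the nonempty words over
`X`, with `(r x) (s y) = (r s) (x y)` for `r, s ∈ R` and words `x, y`. -/
abbrev FreeRing (R : Type w) [Ring R] (E : WeightedGraph.{u, v}) : Type _ :=
  MonoidAlgebra R (FreeSemigroup E.Gen)

section Relators
variable (R : Type w) [Ring R] (E : WeightedGraph.{u, v})

/-- A generator as an element of the free `R`-ring. -/
noncomputable def gen (x : E.Gen) : FreeRing R E := MonoidAlgebra.single (FreeSemigroup.of x) 1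

/-- A vertex as an element of the free `R`-ring. -/
noncomputable def vertex (v : E.Vert) : FreeRing R E := E.gen R (.vert v)

/-- The edge `α_{i+1}` as an element of the free `R`-ring, zero if `i + 1 > ω(α)`. -/
noncomputable def edge (α : E.SEdge) (i : ℕ) : FreeRing R E :=
  if h : i < E.weight α then E.gen R (.edge α ⟨i, h⟩) else 0

/-- The ghost edge `α_{i+1}^*` as an element of the free `R`-ring, zero if `i + 1 > ω(α)`. -/
noncomputable def ghost (α : E.SEdge) (i : ℕ) : FreeRing R E :=
  if h : i < E.weight α then E.gen R (.ghost α ⟨i, h⟩) else 0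

open Classical in
/-- The elements "left hand side minus right hand side" of the defining relations of the
weighted Leavitt path algebra. -/
inductive Relator : FreeRing R E → Prop
  | vert_mul_vert (v w : E.Vert) :
      Relator (E.vertex R v * E.vertex R w - if v = w then E.vertex R v else 0)
  | src_mul_edge (α : E.SEdge) (i : ℕ) (hi : i < E.weight α) :
      Relator (E.vertex R (E.src α) * E.edge R α i - E.edge R α i)
  | edge_mul_rng (α : E.SEdge) (i : ℕ) (hi : i < E.weight α) :
      Relator (E.edge R α i * E.vertex R (E.rng α) - E.edge R α i)
  | rng_mul_ghost (α : E.SEdge) (i : ℕ) (hi : i < E.weight α) :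
      Relator (E.vertex R (E.rng α) * E.ghost R α i - E.ghost R α i)
  | ghost_mul_src (α : E.SEdge) (i : ℕ) (hi : i < E.weight α) :
      Relator (E.ghost R α i * E.vertex R (E.src α) - E.ghost R α i)
  | edge_mul_ghost (v : E.Vert) (i j : ℕ) (hi : i < E.vertWeight v) (hj : j < E.vertWeight v) :
      Relator (∑ α ∈ E.out v, E.edge R α i * E.ghost R α j - if i = j then E.vertex R v else 0)
  | ghost_mul_edge (α β : E.SEdge) :
      Relator (∑ i ∈ Finset.range (max (E.weight α) (E.weight β)),
        E.ghost R α i * E.edge R β i - if α = β then E.vertex R (E.rng α) else 0)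

/-- The ideal of the `R`-ring `R⟨X⟩` (that is, the two-sided ideal which is an `R`-subbimodule)
generated by the relators. Since scalars and words commute in `R⟨X⟩`, it is the ideal of the ring
`R⟨X⟩` generated by the elements `r y s = (r • y) <• s` for `r, s ∈ R` and relators `y`. -/
noncomputable def relIdeal : TwoSidedIdeal (FreeRing R E) :=
  TwoSidedIdeal.span {z | ∃ (r s : R) (y : FreeRing R E),
    E.Relator R y ∧ z = MulOpposite.op s • (r • y)}

theorem smul_mem_relIdeal (t : R) {x : FreeRing R E} (hx : x ∈ E.relIdeal R) :
    t • x ∈ E.relIdeal R := by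
  refine TwoSidedIdeal.span_induction (p := fun x _ => t • x ∈ E.relIdeal R) ?_ ?_ ?_ ?_ ?_ ?_ hx
  · rintro x ⟨r, s, y, hy, rfl⟩
    refine TwoSidedIdeal.subset_span ⟨t * r, s, y, hy, ?_⟩
    rw [smul_comm, smul_smul]
  · rw [smul_zero]; exact (E.relIdeal R).zero_mem
  · intro x y _ _ hx hy
    rw [smul_add]; exact (E.relIdeal R).add_mem hx hy
  · intro x _ hx
    rw [smul_neg]; exact (E.relIdeal R).neg_mem hx
  · intro a x hx _
    rw [← smul_mul_assoc]; exact (E.relIdeal R).mul_mem_left _ _ hx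
  · intro b x _ hx
    rw [← smul_mul_assoc]; exact (E.relIdeal R).mul_mem_right _ _ hx

theorem op_smul_mem_relIdeal (t : R) {x : FreeRing R E} (hx : x ∈ E.relIdeal R) :
    MulOpposite.op t • x ∈ E.relIdeal R := by
  refine TwoSidedIdeal.span_induction
    (p := fun x _ => MulOpposite.op t • x ∈ E.relIdeal R) ?_ ?_ ?_ ?_ ?_ ?_ hx
  · rintro x ⟨r, s, y, hy, rfl⟩
    refine TwoSidedIdeal.subset_span ⟨r, s * t, y, hy, ?_⟩
    rw [smul_smul, MulOpposite.op_mul]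
  · rw [smul_zero]; exact (E.relIdeal R).zero_mem
  · intro x y _ _ hx hy
    rw [smul_add]; exact (E.relIdeal R).add_mem hx hy
  · intro x _ hx
    rw [smul_neg]; exact (E.relIdeal R).neg_mem hx
  · intro a x _ hx
    rw [← mul_smul_comm]; exact (E.relIdeal R).mul_mem_left _ _ hx
  · intro b x hx _
    rw [← mul_smul_comm]; exact (E.relIdeal R).mul_mem_right _ _ hx

/-- The weighted Leavitt path algebra `L_R(E, ω) = R⟨X⟩ / I`, a ring without unit in general. -/
abbrev LeavittPathRing : Type _ := (E.relIdeal R).ringCon.Quotient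

/-- The projection `R⟨X⟩ → L_R(E, ω)`. -/
noncomputable def proj (x : FreeRing R E) : LeavittPathRing R E := (x : (E.relIdeal R).ringCon.Quotient)

/-- The left `R`-module structure of `L_R(E, ω)`, `r • [x] = [r • x]`. -/
noncomputable instance instModuleLeavittPathRing : Module R (LeavittPathRing R E) where
  smul r := Quotient.map' (fun x => r • x) fun x y h => by
    have h' := ((E.relIdeal R).rel_iff x y).1 h
    refine ((E.relIdeal R).rel_iff (r • x) (r • y)).2 ?_
    rw [← smul_sub]; exact E.smul_mem_relIdeal R r h'
  one_smul := by rintro ⟨x⟩; exact congrArg (E.proj R) (one_smul R x)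
  mul_smul r s := by rintro ⟨x⟩; exact congrArg (E.proj R) (mul_smul r s x)
  smul_zero r := congrArg (E.proj R) (smul_zero r)
  smul_add r := by rintro ⟨x⟩ ⟨y⟩; exact congrArg (E.proj R) (smul_add r x y)
  add_smul r s := by rintro ⟨x⟩; exact congrArg (E.proj R) (add_smul r s x)
  zero_smul := by rintro ⟨x⟩; exact congrArg (E.proj R) (zero_smul R x)

end Relators

section Grading
variable (E : WeightedGraph.{u, v})

/-- The indices of edges. These are the first `n` natural numbers, where `n ∈ ℕ ∪ {∞}` is the
supremum of the weights of all structured edges. -/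
abbrev EdgeIndex : Type := {i : ℕ // ∃ α, i < E.weight α}

/-- The grading group `ℤⁿ` (the direct sum of countably many copies of `ℤ` if `n = ∞`). -/
abbrev GradingGroup : Type := E.EdgeIndex →₀ ℤ

/-- The degree of a generator: `0` for vertices, `eᵢ` for `αᵢ`, and `-eᵢ` for `αᵢ^*`. -/
noncomputable def genDegree : E.Gen → E.GradingGroup
  | .vert _ => 0
  | .edge α i => Finsupp.single ⟨i, α, i.isLt⟩ 1
  | .ghost α i => -Finsupp.single ⟨i, α, i.isLt⟩ 1

/-- The degree of a word: the sum of the degrees of its letters. -/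
noncomputable def wordDegree (x : FreeSemigroup E.Gen) : E.GradingGroup :=
  E.genDegree x.head + (x.tail.map E.genDegree).sum

variable (R : Type w) [Ring R]

/-- The homogeneous component of degree `g` of `L_R(E, ω)`: the `R`-span of the images of the
words of degree `g`. -/
noncomputable def component (g : E.GradingGroup) : Submodule R (LeavittPathRing R E) :=
  Submodule.span R
    {a | ∃ x : FreeSemigroup E.Gen, E.wordDegree x = g ∧ a = E.proj R (MonoidAlgebra.single x 1)}

variable {R}

/-- A graded ideal of `L_R(E, ω)`: a two-sided ideal `J` every element of which is a sum of
homogeneous elements of `J`. -/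
def IsGradedIdeal (J : TwoSidedIdeal (LeavittPathRing R E)) : Prop :=
  ∀ a ∈ J, a ∈ AddSubgroup.closure {b | b ∈ J ∧ ∃ g, b ∈ E.component R g}

/-- A proper ideal of `L_R(E, ω)`: one different from zero and from the whole ring. -/
def IsProperIdeal (J : TwoSidedIdeal (LeavittPathRing R E)) : Prop := J ≠ ⊥ ∧ J ≠ ⊤

variable (R)

/-- `L_R(E, ω)` is graded simple: its multiplication is not identically zero and it has no proper
graded ideal. -/
def IsGradedSimple : Prop :=
  (∃ a b : LeavittPathRing R E, a * b ≠ 0) ∧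
    ¬ ∃ J : TwoSidedIdeal (LeavittPathRing R E), E.IsGradedIdeal J ∧ E.IsProperIdeal J

end Grading

end WeightedGraph

/-!
Replace every vertex by a copy of `ℕ`. A bijection at each vertex then makes the edges act on
`E.Vert × ℕ` by partial injections which satisfy the defining relations, so `L_R(E, ω)` acts on the
functions on `E.Vert × ℕ`. If a word acts as zero for one choice of bijections and not for another,
the ideal which it generates is graded and proper.

If the weight forest is not as in the definition of reducibility, there are a vertex `v` of the
forest, an edge `β` of maximal weight leaving `v`, and paths `x` and `y` ending in the source and in
the range of `β` whose action does not depend on the bijection at `v`. The range of `x` and the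
set of points of `β` which `y` reaches are infinite with infinite complement in the two sides of
the bijection at `v`. That bijection can therefore be chosen to separate them or not, that is, to
make the word `x β_1 y^*` act as zero or not.
-/

namespace WeightedGraph

section PartialInjections

variable {X Y T : Type*}

theorem pequiv_ext_mem {φ ψ : X ≃. Y} (h : ∀ a b, b ∈ φ a ↔ b ∈ ψ a) : φ = ψ :=
  PEquiv.ext fun a => Option.ext fun b => h a b

theorem ne_bot_iff_exists_mem {φ : X ≃. Y} : φ ≠ ⊥ ↔ ∃ a b, b ∈ φ a := by
  rw [Ne, PEquiv.ext_iff, not_forall]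
  exact exists_congr fun a => Option.ne_none_iff_exists'

open Classical in
/-- The partial injection whose graph is a given bi-unique relation. -/
noncomputable def pequivOfRel (r : X → Y → Prop) (hr : Relator.BiUnique r) : X ≃. Y where
  toFun a := if h : ∃ b, r a b then some h.choose else none
  invFun b := if h : ∃ a, r a b then some h.choose else none
  inv a b := by
    simp only [Option.dite_none_right_eq_some, Option.some_inj]
    constructor
    · rintro ⟨h, rfl⟩
      have hb : ∃ b', r h.choose b' := ⟨b, h.choose_spec⟩
      exact ⟨hb, hr.2 hb.choose_spec h.choose_spec⟩
    · rintro ⟨h, rfl⟩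
      have ha : ∃ a', r a' h.choose := ⟨a, h.choose_spec⟩
      exact ⟨ha, hr.1 ha.choose_spec h.choose_spec⟩

theorem mem_pequivOfRel {r : X → Y → Prop} {hr : Relator.BiUnique r} {a : X} {b : Y} :
    b ∈ pequivOfRel r hr a ↔ r a b := by
  simp only [pequivOfRel, PEquiv.coe_mk_apply, Option.mem_def, Option.dite_none_right_eq_some,
    Option.some_inj]
  exact ⟨fun ⟨h, hb⟩ => hb ▸ h.choose_spec, fun h => ⟨⟨b, h⟩, hr.2 (Exists.choose_spec _) h⟩⟩

scoped instance : Semigroup (T ≃. T) where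
  mul := PEquiv.trans
  mul_assoc := PEquiv.trans_assoc

theorem mem_mul {φ ψ : T ≃. T} {p r : T} : r ∈ (φ * ψ) p ↔ ∃ q, q ∈ φ p ∧ r ∈ ψ q :=
  PEquiv.mem_trans φ ψ p r

theorem symm_mul (φ ψ : T ≃. T) : (φ * ψ).symm = ψ.symm * φ.symm := rfl

theorem ofSet_mul_of_dom_subset {s : Set T} [DecidablePred (· ∈ s)] {φ : T ≃. T}
    (h : ∀ p q, q ∈ φ p → p ∈ s) : PEquiv.ofSet s * φ = φ := by
  refine pequiv_ext_mem fun p q => mem_mul.trans ?_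
  simp only [PEquiv.mem_ofSet_iff]
  exact ⟨fun ⟨_, ⟨rfl, _⟩, hq⟩ => hq, fun hq => ⟨p, ⟨rfl, h p q hq⟩, hq⟩⟩

theorem mul_ofSet_of_range_subset {s : Set T} [DecidablePred (· ∈ s)] {φ : T ≃. T}
    (h : ∀ p q, q ∈ φ p → q ∈ s) : φ * PEquiv.ofSet s = φ := by
  refine pequiv_ext_mem fun p q => mem_mul.trans ?_
  simp only [PEquiv.mem_ofSet_iff]
  exact ⟨fun ⟨_, hq, ⟨rfl, _⟩⟩ => hq, fun hq => ⟨q, hq, rfl, h p q hq⟩⟩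

variable (R : Type*) [Ring R]

/-- The action of partial injections on functions by precomposition, with the value `0` at the
points where the partial injection is not defined. -/
def pullback : (T ≃. T) →ₙ* AddMonoid.End (T → R) where
  toFun φ :=
    { toFun f p := (φ p).elim 0 f
      map_zero' := by ext p; cases φ p <;> rfl
      map_add' f g := by
        ext p
        change (φ p).elim 0 (f + g) = (φ p).elim 0 f + (φ p).elim 0 g
        cases φ p
        · exact (add_zero 0).symm
        · rfl }
  map_mul' φ ψ := by
    ext f p
    change ((φ p).bind ψ).elim 0 f = (φ p).elim 0 fun q => (ψ q).elim 0 f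
    cases φ p <;> rfl

variable {R}

theorem pullback_apply (φ : T ≃. T) (f : T → R) (p : T) : pullback R φ f p = (φ p).elim 0 f := rfl

theorem pullback_apply_of_mem {φ : T ≃. T} {p q : T} (h : q ∈ φ p) (f : T → R) :
    pullback R φ f p = f q := by
  rw [pullback_apply, Option.mem_def.1 h, Option.elim_some]

theorem pullback_bot : pullback R (⊥ : T ≃. T) = 0 := rfl

theorem pullback_ne_zero [Nontrivial R] {φ : T ≃. T} (h : φ ≠ ⊥) : pullback R φ ≠ 0 := by
  obtain ⟨p, q, hpq⟩ := ne_bot_iff_exists_mem.1 h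
  intro h0
  have hone : pullback R φ (fun _ => 1) p = 1 := pullback_apply_of_mem hpq _
  exact zero_ne_one ((congrFun (DFunLike.congr_fun h0 fun _ => (1 : R)) p).symm.trans hone)

theorem pullback_ofSet (s : Set T) [DecidablePred (· ∈ s)] (f : T → R) :
    pullback R (PEquiv.ofSet s) f = s.indicator f := by
  classical
  ext p
  rw [pullback_apply, Set.indicator_apply]
  by_cases hp : p ∈ s
  · rw [PEquiv.ofSet_eq_some_self_iff.2 hp, Option.elim_some, if_pos hp]
  · rw [if_neg hp, show PEquiv.ofSet s p = none from if_neg hp, Option.elim_none]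

theorem sum_pullback_mul_symm {ι : Type*} (s : Finset ι) (φ : ι → T ≃. T) (U : Set T)
    [DecidablePred (· ∈ U)] (hdom : ∀ p, p ∈ U ↔ ∃ k ∈ s, ∃ q, q ∈ φ k p)
    (hdisj : ∀ k l p q r, q ∈ φ k p → r ∈ φ l p → k = l) :
    ∑ k ∈ s, pullback R (φ k * (φ k).symm) = pullback R (PEquiv.ofSet U) := by
  have hterm (k : ι) (f : T → R) :
      pullback R (φ k * (φ k).symm) f = {p | ∃ q, q ∈ φ k p}.indicator f := by
    classical
    rw [show φ k * (φ k).symm = _ from (φ k).self_trans_symm, pullback_ofSet]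
    simp only [Option.isSome_iff_exists, Option.mem_def]
  have hU : U = ⋃ k ∈ s, {p | ∃ q, q ∈ φ k p} := by
    ext p
    simpa only [Set.mem_iUnion, Set.mem_ofPred_eq, exists_prop] using hdom p
  have hpairwise : (s : Set ι).PairwiseDisjoint fun k => {p | ∃ q, q ∈ φ k p} :=
    fun k _ l _ hkl => Set.disjoint_left.2 fun p ⟨q, hq⟩ ⟨r, hr⟩ => hkl (hdisj k l p q r hq hr)
  ext f : 1
  calc (∑ k ∈ s, pullback R (φ k * (φ k).symm)) f
      = ∑ k ∈ s, pullback R (φ k * (φ k).symm) f := map_sum (AddMonoidHom.eval f) _ s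
    _ = ∑ k ∈ s, {p | ∃ q, q ∈ φ k p}.indicator f := Finset.sum_congr rfl fun k _ => hterm k f
    _ = U.indicator f := by
      rw [hU, Finset.indicator_biUnion s _ hpairwise]
      exact funext fun p => Finset.sum_apply p s _
    _ = pullback R (PEquiv.ofSet U) f := (pullback_ofSet U f).symm

variable (R) in
/-- Left multiplication of functions by scalars. -/
def scalar (T : Type*) : R →+* AddMonoid.End (T → R) := Module.toAddMonoidEnd R (T → R)

theorem commute_scalar_pullback (r : R) (φ : T ≃. T) :
    Commute (scalar R T r) (pullback R φ) := by
  ext f p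
  change r * (φ p).elim 0 f = (φ p).elim 0 fun q => r * f q
  cases φ p
  · exact mul_zero r
  · rfl

end PartialInjections

section Graph

variable {E : WeightedGraph.{u, v}}

theorem mem_out {α : E.SEdge} {v : E.Vert} : α ∈ E.out v ↔ E.src α = v :=
  (E.rowFinite v).mem_toFinset

theorem weight_le_vertWeight (α : E.SEdge) : E.weight α ≤ E.vertWeight (E.src α) :=
  Finset.le_sup (f := E.weight) (mem_out.2 rfl)

theorem vertWeight_src_pos (α : E.SEdge) : 0 < E.vertWeight (E.src α) :=
  (E.weight_pos α).trans_le (E.weight_le_vertWeight α)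

theorem exists_weight_eq_vertWeight {v : E.Vert} (hv : (E.src ⁻¹' {v}).Nonempty) :
    ∃ β, E.src β = v ∧ E.weight β = E.vertWeight v := by
  obtain ⟨β, hβ, h⟩ := (E.out v).exists_mem_eq_sup (hv.imp fun α hα => mem_out.2 hα) E.weight
  exact ⟨β, mem_out.1 hβ, h.symm⟩

variable (E) in
/-- The vertices which emit at least two structured edges. -/
def branchingVerts : Set E.Vert := {v | (E.src ⁻¹' {v}).Nontrivial}

end Graph

section BranchingSystems

/-- A solution by sets of the relations `∑ αᵢ αⱼ^* = δᵢⱼ v` and `∑ αᵢ^* βᵢ = δ_{αβ} r(α)` for the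
structured edges emitted by `v`, when every vertex is replaced by a copy of `ℕ`. An equality
`toEquiv (α, t) = (s, i)` says that `αᵢ` takes the point `s` over `v` to the point `t` over
`r(α)`. -/
structure LocalSystem (E : WeightedGraph.{u, v}) (v : E.Vert) where
  toEquiv : {α // E.src α = v} × ℕ ≃ ℕ × Fin (E.vertWeight v)
  snd_lt : ∀ x, ((toEquiv x).2 : ℕ) < E.weight x.1

/-- A family of local systems. It makes `E.Vert × ℕ` a set on which the edges of `E` act by partial
injections, with the second component labelling the points over a given vertex. -/
abbrev BranchingSystem (E : WeightedGraph.{u, v}) : Type _ := ∀ v, LocalSystem E v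

namespace BranchingSystem

variable {E : WeightedGraph.{u, v}} (S S' : BranchingSystem E)

/-- The graph of the partial injection of `E.Vert × ℕ` given by the edge `α_{i+1}`; it is empty if
`i + 1 > ω(α)`. -/
def EdgeRel (α : E.SEdge) (i : ℕ) (p q : E.Vert × ℕ) : Prop :=
  q.1 = E.rng α ∧ ∃ (hα : E.src α = p.1) (hi : i < E.vertWeight p.1),
    (S p.1).toEquiv (⟨α, hα⟩, q.2) = (p.2, ⟨i, hi⟩)

variable {S S'} {α β : E.SEdge} {i j : ℕ} {p p' q q' : E.Vert × ℕ}

theorem EdgeRel.source_unique (h : S.EdgeRel α i p q) (h' : S.EdgeRel α j p' q) :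
    p = p' ∧ i = j := by
  obtain ⟨v, s⟩ := p
  obtain ⟨v', s'⟩ := p'
  obtain ⟨-, hp, hi, h⟩ := h
  obtain ⟨-, hp', hj, h'⟩ := h'
  obtain rfl : E.src α = v := hp
  obtain rfl : E.src α = v' := hp'
  simpa using h.symm.trans h'

theorem EdgeRel.target_unique (h : S.EdgeRel α i p q) (h' : S.EdgeRel β i p q') :
    α = β ∧ q = q' := by
  obtain ⟨hq, hα, hi, h⟩ := h
  obtain ⟨hq', hβ, _, h'⟩ := h'
  have hx : ((⟨α, hα⟩, q.2) : {α // E.src α = p.1} × ℕ) = (⟨β, hβ⟩, q'.2) :=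
    (S p.1).toEquiv.injective (h.trans h'.symm)
  simp only [Prod.mk.injEq, Subtype.mk.injEq] at hx
  exact ⟨hx.1, Prod.ext (by rw [hq, hq', hx.1]) hx.2⟩

theorem EdgeRel.source (h : S.EdgeRel α i p q) : E.src α = p.1 := h.2.choose

theorem EdgeRel.target (h : S.EdgeRel α i p q) : q.1 = E.rng α := h.1

theorem EdgeRel.lt_weight (h : S.EdgeRel α i p q) : i < E.weight α := by
  obtain ⟨-, hα, hi, h⟩ := h
  simpa only [h] using (S p.1).snd_lt (⟨α, hα⟩, q.2)

theorem exists_edgeRel_of_source (hi : i < E.vertWeight p.1) :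
    ∃ α, E.src α = p.1 ∧ ∃ q, S.EdgeRel α i p q := by
  obtain ⟨⟨⟨α, hα⟩, t⟩, h⟩ := (S p.1).toEquiv.surjective (p.2, ⟨i, hi⟩)
  exact ⟨α, hα, (E.rng α, t), rfl, hα, hi, h⟩

theorem exists_edgeRel_of_target (hq : q.1 = E.rng α) :
    ∃ i < E.weight α, ∃ p, S.EdgeRel α i p q := by
  set x := (S (E.src α)).toEquiv (⟨α, rfl⟩, q.2) with hx
  have h : S.EdgeRel α x.2 (E.src α, x.1) q := ⟨hq, rfl, x.2.isLt, hx.symm⟩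
  exact ⟨_, h.lt_weight, _, h⟩

theorem edgeRel_congr (h : S (E.src α) = S' (E.src α)) : S.EdgeRel α i = S'.EdgeRel α i := by
  ext ⟨v, s⟩ q
  refine and_congr_right fun _ => exists_congr fun hα => ?_
  obtain rfl : E.src α = v := hα
  rw [h]

variable (S)

/-- The partial injection given by the edge `α_{i+1}`. -/
noncomputable def edgeMap (α : E.SEdge) (i : ℕ) : (E.Vert × ℕ) ≃. (E.Vert × ℕ) :=
  pequivOfRel (S.EdgeRel α i)
    ⟨fun _ _ _ h h' => (h.source_unique h').1, fun _ _ _ h h' => (h.target_unique h').2⟩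

theorem mem_edgeMap : q ∈ S.edgeMap α i p ↔ S.EdgeRel α i p q := mem_pequivOfRel

variable {S} in
theorem edgeMap_congr (h : S (E.src α) = S' (E.src α)) (i : ℕ) : S.edgeMap α i = S'.edgeMap α i :=
  pequiv_ext_mem fun p q => by rw [mem_edgeMap, mem_edgeMap, edgeRel_congr h]

theorem edgeMap_eq_bot (hi : E.weight α ≤ i) : S.edgeMap α i = ⊥ := by
  by_contra h
  obtain ⟨p, q, hpq⟩ := ne_bot_iff_exists_mem.1 h
  exact (S.mem_edgeMap.1 hpq).lt_weight.not_ge hi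

open Classical in
variable (E) in
/-- The partial identity given by the vertex `v`, defined at the points over `v`. -/
noncomputable def vertMap (v : E.Vert) : (E.Vert × ℕ) ≃. (E.Vert × ℕ) :=
  PEquiv.ofSet {p | p.1 = v}

theorem mem_vertMap {v : E.Vert} : q ∈ vertMap E v p ↔ q = p ∧ q.1 = v := by
  classical exact PEquiv.mem_ofSet_iff

theorem vertMap_symm (v : E.Vert) : (vertMap E v).symm = vertMap E v := rfl

theorem vertMap_mul_of_source {v : E.Vert} {φ : (E.Vert × ℕ) ≃. (E.Vert × ℕ)}
    (h : ∀ p q, q ∈ φ p → p.1 = v) : vertMap E v * φ = φ :=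
  by classical exact ofSet_mul_of_dom_subset h

theorem mul_vertMap_of_target {v : E.Vert} {φ : (E.Vert × ℕ) ≃. (E.Vert × ℕ)}
    (h : ∀ p q, q ∈ φ p → q.1 = v) : φ * vertMap E v = φ :=
  by classical exact mul_ofSet_of_range_subset h

theorem vertMap_mul_vertMap_of_ne {v w : E.Vert} (h : v ≠ w) : vertMap E v * vertMap E w = ⊥ := by
  by_contra hne
  obtain ⟨p, r, hpr⟩ := ne_bot_iff_exists_mem.1 hne
  obtain ⟨q, hpq, hqr⟩ := mem_mul.1 hpr
  obtain ⟨-, hq⟩ := mem_vertMap.1 hpq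
  obtain ⟨rfl, hr⟩ := mem_vertMap.1 hqr
  exact h (hq.symm.trans hr)

theorem edgeMap_mul_symm_of_ne (α : E.SEdge) (h : i ≠ j) :
    S.edgeMap α i * (S.edgeMap α j).symm = ⊥ := by
  by_contra hne
  obtain ⟨p, r, hpr⟩ := ne_bot_iff_exists_mem.1 hne
  obtain ⟨q, hpq, hqr⟩ := mem_mul.1 hpr
  rw [PEquiv.mem_iff_mem, mem_edgeMap] at hqr
  exact h ((S.mem_edgeMap.1 hpq).source_unique hqr).2

theorem symm_mul_edgeMap_of_ne (h : α ≠ β) (i : ℕ) :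
    (S.edgeMap α i).symm * S.edgeMap β i = ⊥ := by
  by_contra hne
  obtain ⟨p, r, hpr⟩ := ne_bot_iff_exists_mem.1 hne
  obtain ⟨q, hpq, hqr⟩ := mem_mul.1 hpr
  rw [PEquiv.mem_iff_mem, mem_edgeMap] at hpq
  exact h (hpq.target_unique (S.mem_edgeMap.1 hqr)).1

/-- The partial injection given by a generator; ghost edges give the inverses of edges. -/
noncomputable def genMap : E.Gen → (E.Vert × ℕ) ≃. (E.Vert × ℕ)
  | .vert v => vertMap E v
  | .edge α i => S.edgeMap α i
  | .ghost α i => (S.edgeMap α i).symm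

/-- The partial injection given by a word. -/
noncomputable def wordMap : FreeSemigroup E.Gen →ₙ* (E.Vert × ℕ) ≃. (E.Vert × ℕ) :=
  FreeSemigroup.lift S.genMap

theorem wordMap_of (x : E.Gen) : S.wordMap (.of x) = S.genMap x := FreeSemigroup.lift_of _ x

end BranchingSystem

end BranchingSystems

section Representation

namespace BranchingSystem

variable {E : WeightedGraph.{u, v}} (S : BranchingSystem E) (R : Type w) [Ring R]

/-- The action of the free `R`-ring on the functions on `E.Vert × ℕ`, extending the action of words
by `pullback`. -/
noncomputable def action : FreeRing R E →ₙ+* AddMonoid.End (E.Vert × ℕ → R) where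
  toFun := MonoidAlgebra.liftNC (scalar R (E.Vert × ℕ) : R →+ AddMonoid.End (E.Vert × ℕ → R))
    ((pullback R).comp S.wordMap)
  map_zero' := map_zero _
  map_add' := map_add _
  map_mul' a b := MonoidAlgebra.liftNC_mul _ _ a b fun _ => commute_scalar_pullback _ _

theorem action_single (x : FreeSemigroup E.Gen) (r : R) :
    S.action R (.single x r) = scalar R _ r * pullback R (S.wordMap x) :=
  MonoidAlgebra.liftNC_single _ _ _ _

theorem action_single_one (x : FreeSemigroup E.Gen) :
    S.action R (.single x 1) = pullback R (S.wordMap x) := by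
  rw [action_single, map_one, one_mul]

theorem action_smul (r : R) (y : FreeRing R E) :
    S.action R (r • y) = scalar R _ r * S.action R y := by
  induction y using MonoidAlgebra.induction_linear with
  | zero => rw [smul_zero, map_zero, mul_zero]
  | add x y hx hy => rw [smul_add, map_add, map_add, hx, hy, mul_add]
  | single x s => rw [MonoidAlgebra.smul_single, action_single, action_single, smul_eq_mul,
      map_mul, mul_assoc]

theorem action_op_smul (s : R) (y : FreeRing R E) :
    S.action R (MulOpposite.op s • y) = S.action R y * scalar R _ s := by
  induction y using MonoidAlgebra.induction_linear with
  | zero => rw [smul_zero, map_zero, zero_mul]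
  | add x y hx hy => rw [smul_add, map_add, map_add, hx, hy, add_mul]
  | single x r => rw [MonoidAlgebra.smul_single, action_single, action_single, op_smul_eq_mul,
      map_mul, mul_assoc, mul_assoc, (commute_scalar_pullback s (S.wordMap x)).eq]

theorem action_gen (x : E.Gen) : S.action R (E.gen R x) = pullback R (S.genMap x) := by
  rw [gen, action_single_one, wordMap_of]

theorem action_vertex (v : E.Vert) : S.action R (E.vertex R v) = pullback R (vertMap E v) :=
  S.action_gen R _

theorem action_edge (α : E.SEdge) (i : ℕ) :
    S.action R (E.edge R α i) = pullback R (S.edgeMap α i) := by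
  rw [edge]
  split_ifs with hi
  · exact S.action_gen R _
  · rw [S.edgeMap_eq_bot (not_lt.1 hi), map_zero, pullback_bot]

theorem action_ghost (α : E.SEdge) (i : ℕ) :
    S.action R (E.ghost R α i) = pullback R (S.edgeMap α i).symm := by
  rw [ghost]
  split_ifs with hi
  · exact S.action_gen R _
  · rw [S.edgeMap_eq_bot (not_lt.1 hi), map_zero, PEquiv.symm_bot, pullback_bot]

theorem action_sum_edge_mul_ghost {v : E.Vert} {i j : ℕ} (hi : i < E.vertWeight v) :
    S.action R (∑ α ∈ E.out v, E.edge R α i * E.ghost R α j) =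
      if i = j then pullback R (vertMap E v) else 0 := by
  simp only [map_sum, map_mul, action_edge, action_ghost]
  simp only [← map_mul]
  split_ifs with hij
  · subst hij
    classical
    refine sum_pullback_mul_symm _ _ _ (fun p => ⟨?_, ?_⟩) fun α β p q r hq hr => ?_
    · rintro rfl
      obtain ⟨α, hα, q, h⟩ := S.exists_edgeRel_of_source hi
      exact ⟨α, mem_out.2 hα, q, S.mem_edgeMap.2 h⟩
    · rintro ⟨α, hα, q, h⟩
      exact (S.mem_edgeMap.1 h).source.symm.trans (mem_out.1 hα)
    · exact ((S.mem_edgeMap.1 hq).target_unique (S.mem_edgeMap.1 hr)).1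
  · exact Finset.sum_eq_zero fun α _ => by rw [S.edgeMap_mul_symm_of_ne α hij, pullback_bot]

open Classical in
theorem action_sum_ghost_mul_edge (α β : E.SEdge) {n : ℕ} (hn : E.weight α ≤ n) :
    S.action R (∑ i ∈ Finset.range n, E.ghost R α i * E.edge R β i) =
      if α = β then pullback R (vertMap E (E.rng α)) else 0 := by
  simp only [map_sum, map_mul, action_edge, action_ghost]
  simp only [← map_mul]
  split_ifs with hαβ
  · subst hαβ
    refine sum_pullback_mul_symm _ (fun i => (S.edgeMap α i).symm) _ (fun q => ⟨fun hq => ?_, ?_⟩)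
      fun i j q p p' hp hp' => ?_
    · obtain ⟨i, hi, p, h⟩ := S.exists_edgeRel_of_target hq
      exact ⟨i, Finset.mem_range.2 (hi.trans_le hn), p,
        (PEquiv.mem_iff_mem _).2 (S.mem_edgeMap.2 h)⟩
    · rintro ⟨i, -, p, h⟩
      exact (S.mem_edgeMap.1 ((PEquiv.mem_iff_mem _).1 h)).target
    · rw [PEquiv.mem_iff_mem, mem_edgeMap] at hp hp'
      exact (hp.source_unique hp').2
  · exact Finset.sum_eq_zero fun i _ => by rw [S.symm_mul_edgeMap_of_ne hαβ, pullback_bot]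

theorem action_relator {y : FreeRing R E} (hy : E.Relator R y) : S.action R y = 0 := by
  have hsource {α i p q} (h : q ∈ S.edgeMap α i p) : p.1 = E.src α :=
    (S.mem_edgeMap.1 h).source.symm
  have htarget {α i p q} (h : q ∈ S.edgeMap α i p) : q.1 = E.rng α := (S.mem_edgeMap.1 h).target
  induction hy with
  | vert_mul_vert v w =>
    rw [map_sub, map_mul, action_vertex, action_vertex, ← map_mul, sub_eq_zero]
    split_ifs with h
    · rw [← h, action_vertex, vertMap_mul_of_source fun p q hq => ?_]
      obtain ⟨rfl, hv⟩ := mem_vertMap.1 hq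
      exact hv
    · rw [vertMap_mul_vertMap_of_ne h, map_zero, pullback_bot]
  | src_mul_edge α i =>
    rw [map_sub, map_mul, action_vertex, action_edge, ← map_mul,
      vertMap_mul_of_source fun p q => hsource, sub_self]
  | edge_mul_rng α i =>
    rw [map_sub, map_mul, action_vertex, action_edge, ← map_mul,
      mul_vertMap_of_target fun p q => htarget, sub_self]
  | rng_mul_ghost α i =>
    rw [map_sub, map_mul, action_vertex, action_ghost, ← map_mul, vertMap_mul_of_source
      fun p q h => htarget ((PEquiv.mem_iff_mem _).1 h), sub_self]
  | ghost_mul_src α i =>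
    rw [map_sub, map_mul, action_vertex, action_ghost, ← map_mul, mul_vertMap_of_target
      fun p q h => hsource ((PEquiv.mem_iff_mem _).1 h), sub_self]
  | edge_mul_ghost v i j hi =>
    rw [map_sub, S.action_sum_edge_mul_ghost R hi, apply_ite (S.action R), map_zero,
      action_vertex, sub_self]
  | ghost_mul_edge α β =>
    rw [map_sub, S.action_sum_ghost_mul_edge R α β (le_max_left _ _), apply_ite (S.action R),
      map_zero, action_vertex, sub_self]

variable {R} in
theorem action_eq_zero_of_mem_relIdeal {x : FreeRing R E} (hx : x ∈ E.relIdeal R) :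
    S.action R x = 0 := by
  suffices h : E.relIdeal R ≤ TwoSidedIdeal.ker (S.action R) from (TwoSidedIdeal.mem_ker _).1 (h hx)
  refine TwoSidedIdeal.span_le.2 ?_
  rintro _ ⟨r, s, y, hy, rfl⟩
  refine (TwoSidedIdeal.mem_ker _).2 ?_
  rw [action_op_smul, action_smul, S.action_relator R hy, mul_zero, zero_mul]

/-- The representation of `L_R(E, ω)` on the functions on `E.Vert × ℕ`. -/
noncomputable def rep : LeavittPathRing R E →ₙ+* AddMonoid.End (E.Vert × ℕ → R) where
  toFun := Quotient.lift (S.action R) fun x y h => sub_eq_zero.1 <| by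
    rw [← map_sub]
    exact S.action_eq_zero_of_mem_relIdeal (((E.relIdeal R).rel_iff x y).1 h)
  map_zero' := map_zero (S.action R)
  map_add' := by rintro ⟨x⟩ ⟨y⟩; exact map_add (S.action R) x y
  map_mul' := by rintro ⟨x⟩ ⟨y⟩; exact map_mul (S.action R) x y

theorem rep_proj_single (x : FreeSemigroup E.Gen) :
    S.rep R (E.proj R (.single x 1)) = pullback R (S.wordMap x) :=
  S.action_single_one R x

end BranchingSystem

end Representation

section Grading

theorem mul_mem_addSubgroupClosure {A : Type*} [NonUnitalNonAssocRing A] {s t u : Set A}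
    (h : ∀ a ∈ s, ∀ b ∈ t, a * b ∈ u) {a b : A} (ha : a ∈ AddSubgroup.closure s)
    (hb : b ∈ AddSubgroup.closure t) : a * b ∈ AddSubgroup.closure u := by
  suffices hs : AddSubgroup.closure s ≤ (AddSubgroup.closure u).comap (AddMonoidHom.mulRight b) from
    hs ha
  refine (AddSubgroup.closure_le _).2 fun a ha => ?_
  suffices ht : AddSubgroup.closure t ≤ (AddSubgroup.closure u).comap (AddMonoidHom.mulLeft a) from
    ht hb
  exact (AddSubgroup.closure_le _).2 fun b hb => AddSubgroup.subset_closure (h a ha b hb)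

variable {E : WeightedGraph.{u, v}} {R : Type w} [Ring R]

theorem wordDegree_mul (x y : FreeSemigroup E.Gen) :
    E.wordDegree (x * y) = E.wordDegree x + E.wordDegree y := by
  simp [wordDegree, add_assoc]

theorem proj_mul (x y : FreeRing R E) : E.proj R (x * y) = E.proj R x * E.proj R y := rfl

theorem proj_smul (r : R) (x : FreeRing R E) : E.proj R (r • x) = r • E.proj R x := rfl

theorem proj_surjective : Function.Surjective (E.proj R) := Quotient.mk''_surjective

theorem proj_single_mem_component (x : FreeSemigroup E.Gen) (r : R) :
    E.proj R (.single x r) ∈ E.component R (E.wordDegree x) := by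
  rw [← mul_one r, ← smul_eq_mul, ← MonoidAlgebra.smul_single, proj_smul]
  exact Submodule.smul_mem _ _ (Submodule.subset_span ⟨x, rfl, rfl⟩)

theorem single_one_mul_smul (x : FreeSemigroup E.Gen) (s : R) (y : FreeRing R E) :
    .single x 1 * (s • y) = s • (.single x 1 * y : FreeRing R E) := by
  induction y using MonoidAlgebra.induction_linear with
  | zero => simp only [smul_zero, mul_zero]
  | add y z hy hz => rw [smul_add, mul_add, mul_add, smul_add, hy, hz]
  | single y t => simp only [MonoidAlgebra.smul_single, MonoidAlgebra.single_mul_single, one_mul]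

theorem mul_mem_component {g h : E.GradingGroup} {a b : LeavittPathRing R E}
    (ha : a ∈ E.component R g) (hb : b ∈ E.component R h) : a * b ∈ E.component R (g + h) := by
  induction ha using Submodule.span_induction with
  | mem a ha =>
    obtain ⟨x, rfl, rfl⟩ := ha
    induction hb using Submodule.span_induction with
    | mem b hb =>
      obtain ⟨y, rfl, rfl⟩ := hb
      rw [← proj_mul, MonoidAlgebra.single_mul_single, ← wordDegree_mul]
      exact proj_single_mem_component _ _
    | zero => rw [mul_zero]; exact zero_mem _
    | add b c _ _ hb hc => rw [mul_add]; exact add_mem hb hc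
    | smul s b _ hb =>
      obtain ⟨y, rfl⟩ := proj_surjective b
      rw [← proj_smul, ← proj_mul, single_one_mul_smul, proj_smul]
      exact Submodule.smul_mem _ s hb
  | zero => rw [zero_mul]; exact zero_mem _
  | add a c _ _ ha hc => rw [add_mul]; exact add_mem ha hc
  | smul s a _ ha =>
    obtain ⟨x, rfl⟩ := proj_surjective a
    obtain ⟨y, rfl⟩ := proj_surjective b
    rw [← proj_smul, ← proj_mul, smul_mul_assoc, proj_smul]
    exact Submodule.smul_mem _ s ha

theorem mem_closure_homogeneous (a : LeavittPathRing R E) :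
    a ∈ AddSubgroup.closure {b | ∃ g, b ∈ E.component R g} := by
  obtain ⟨x, rfl⟩ := proj_surjective a
  induction x using MonoidAlgebra.induction_linear with
  | zero => exact zero_mem _
  | add x y hx hy => exact add_mem hx hy
  | single x r => exact AddSubgroup.subset_closure ⟨_, proj_single_mem_component x r⟩

theorem isGradedIdeal_span {s : Set (LeavittPathRing R E)}
    (hs : ∀ a ∈ s, ∃ g, a ∈ E.component R g) : E.IsGradedIdeal (TwoSidedIdeal.span s) := by
  set J := TwoSidedIdeal.span s
  intro a ha
  induction ha using TwoSidedIdeal.span_induction with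
  | mem a ha => exact AddSubgroup.subset_closure ⟨TwoSidedIdeal.subset_span ha, hs a ha⟩
  | zero => exact zero_mem _
  | add a b _ _ ha hb => exact add_mem ha hb
  | neg a _ ha => exact neg_mem ha
  | left_absorb b a _ ha =>
    refine mul_mem_addSubgroupClosure ?_ (mem_closure_homogeneous b) ha
    exact fun b ⟨g, hb⟩ a ⟨haJ, h, ha⟩ => ⟨J.mul_mem_left _ _ haJ, g + h, mul_mem_component hb ha⟩
  | right_absorb b a _ ha =>
    refine mul_mem_addSubgroupClosure ?_ ha (mem_closure_homogeneous b)
    exact fun a ⟨haJ, h, ha⟩ b ⟨g, hb⟩ => ⟨J.mul_mem_right _ _ haJ, h + g, mul_mem_component ha hb⟩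

end Grading

section SeparatingWords

variable {E : WeightedGraph.{u, v}}

variable (E) in
/-- Some word acts as zero in one branching system and as a nonzero partial injection in another. -/
def HasSeparatingWord : Prop :=
  ∃ (z : FreeSemigroup E.Gen) (S S' : BranchingSystem E), S.wordMap z = ⊥ ∧ S'.wordMap z ≠ ⊥

theorem exists_properGradedIdeal_of_hasSeparatingWord (hE : E.HasSeparatingWord) {R : Type w}
    [Ring R] [Nontrivial R] :
    ∃ J : TwoSidedIdeal (LeavittPathRing R E), E.IsGradedIdeal J ∧ E.IsProperIdeal J := by
  obtain ⟨z, S, S', hS, hS'⟩ := hE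
  set a := E.proj R (.single z 1) with ha
  have hvert : ∃ v : E.Vert, BranchingSystem.vertMap E v ≠ ⊥ := by
    obtain ⟨p, -⟩ := ne_bot_iff_exists_mem.1 hS'
    exact ⟨p.1, ne_bot_iff_exists_mem.2 ⟨p, p, BranchingSystem.mem_vertMap.2 ⟨rfl, rfl⟩⟩⟩
  refine ⟨TwoSidedIdeal.span {a}, isGradedIdeal_span ?_, fun h => ?_, fun h => ?_⟩
  · rintro _ rfl
    exact ⟨_, proj_single_mem_component z 1⟩
  · have ha0 : a = 0 := (TwoSidedIdeal.mem_bot _).1 (h ▸ TwoSidedIdeal.subset_span rfl)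
    refine pullback_ne_zero (R := R) hS' ?_
    rw [← BranchingSystem.rep_proj_single, ← ha, ha0, map_zero]
  · obtain ⟨v, hv⟩ := hvert
    have hker : TwoSidedIdeal.span {a} ≤ TwoSidedIdeal.ker (S.rep R) := by
      refine TwoSidedIdeal.span_le.2 (Set.singleton_subset_iff.2 ?_)
      refine (TwoSidedIdeal.mem_ker _).2 ?_
      rw [ha, BranchingSystem.rep_proj_single, hS, pullback_bot]
    have hmem : E.proj R (E.vertex R v) ∈ TwoSidedIdeal.ker (S.rep R) := hker (h ▸ trivial)
    refine pullback_ne_zero (R := R) hv ?_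
    rw [← S.action_vertex R v]
    exact (TwoSidedIdeal.mem_ker _).1 hmem

end SeparatingWords

section LocalSystems

/-- An infinite set with infinite complement. -/
def IsMoiety {X : Type*} (s : Set X) : Prop := s.Infinite ∧ sᶜ.Infinite

theorem IsMoiety.compl {X : Type*} {s : Set X} (hs : IsMoiety s) : IsMoiety sᶜ :=
  ⟨hs.2, by rw [compl_compl]; exact hs.1⟩

theorem IsMoiety.sdiff_singleton {X : Type*} {s : Set X} (hs : IsMoiety s) (a : X) :
    IsMoiety (s \ {a}) :=
  ⟨hs.1.sdiff (Set.finite_singleton a), hs.2.mono (Set.compl_subset_compl.2 Set.sdiff_subset)⟩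

theorem IsMoiety.preimage_of_surjective {X Y : Type*} {f : X → Y} (hf : f.Surjective) {s : Set Y}
    (hs : IsMoiety s) : IsMoiety (f ⁻¹' s) :=
  ⟨hs.1.preimage (by simp only [hf.range_eq, Set.subset_univ]),
    hs.2.preimage (by simp only [hf.range_eq, Set.subset_univ])⟩

theorem IsMoiety.image_of_injective {X Y : Type*} {f : X → Y} (hf : f.Injective) {s : Set X}
    (hs : IsMoiety s) : IsMoiety (f '' s) :=
  ⟨hs.1.image hf.injOn, (hs.2.image hf.injOn).mono (Set.image_compl_subset hf)⟩

theorem IsMoiety.exists_equiv_mem_iff {X Y : Type*} [Countable X] [Countable Y] {P : Set X}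
    {Q : Set Y} (hP : IsMoiety P) (hQ : IsMoiety Q) : ∃ e : X ≃ Y, ∀ x, e x ∈ Q ↔ x ∈ P := by
  classical
  have := hP.1.to_subtype
  have := hP.2.to_subtype
  have := hQ.1.to_subtype
  have := hQ.2.to_subtype
  obtain ⟨f⟩ : Nonempty (P ≃ Q) := nonempty_equiv_of_countable
  obtain ⟨g⟩ : Nonempty (↥Pᶜ ≃ ↥Qᶜ) := nonempty_equiv_of_countable
  refine ⟨(Equiv.Set.sumCompl P).symm.trans ((f.sumCongr g).trans (Equiv.Set.sumCompl Q)),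
    fun x => ?_⟩
  by_cases hx : x ∈ P
  · simp [Equiv.Set.sumCompl_symm_apply_of_mem hx, hx]
  · have hgx : (g ⟨x, hx⟩ : Y) ∉ Q := (g ⟨x, hx⟩).2
    simpa [Equiv.Set.sumCompl_symm_apply_of_notMem hx, hx] using hgx

theorem exists_isMoiety_subset {X : Type*} {s : Set X} (hs : s.Infinite) :
    ∃ t ⊆ s, IsMoiety t := by
  obtain ⟨t, u, rfl, hdisj, hcard⟩ := hs.exists_union_disjoint_cardinal_eq_of_infinite
  have hfinite : t.Finite ↔ u.Finite := (Cardinal.eq.1 hcard).some.set_finite_iff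
  have ht : t.Infinite := fun h => hs (h.union (hfinite.1 h))
  have hu : u.Infinite := mt hfinite.2 ht
  exact ⟨t, Set.subset_union_left, ht, hu.mono hdisj.subset_compl_left⟩

theorem infinite_fst_eq {X Y : Type*} [Infinite Y] (x : X) : {z : X × Y | z.1 = x}.Infinite :=
  Set.infinite_of_injective_forall_mem (Prod.mk_right_injective x) fun _ => rfl

theorem infinite_snd_eq {X Y : Type*} [Infinite X] (y : Y) : {z : X × Y | z.2 = y}.Infinite :=
  Set.infinite_of_injective_forall_mem (Prod.mk_left_injective y) fun _ => rfl

theorem isMoiety_fst_eq {X Y : Type*} [Nontrivial X] [Infinite Y] (x : X) :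
    IsMoiety {z : X × Y | z.1 = x} := by
  obtain ⟨x', hx'⟩ := exists_ne x
  exact ⟨infinite_fst_eq x, (infinite_fst_eq x').mono fun z hz hzx => hx' (hz.symm.trans hzx)⟩

theorem isMoiety_snd_eq {X Y : Type*} [Infinite X] [Nontrivial Y] (y : Y) :
    IsMoiety {z : X × Y | z.2 = y} :=
  (isMoiety_fst_eq y).preimage_of_surjective Prod.swap_surjective

variable {E : WeightedGraph.{u, v}}

theorem exists_localSystem_mem_iff {β : E.SEdge} (hβ : E.weight β = E.vertWeight (E.src β))
    {P : Set ({α // E.src α = E.src β} × ℕ)} (hPβ : ∀ z ∈ P, z.1 = ⟨β, rfl⟩) (hP : IsMoiety P)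
    {C : Set (ℕ × Fin (E.vertWeight (E.src β)))} (hC0 : ∀ c ∈ C, (c.2 : ℕ) = 0)
    (hC : IsMoiety C) :
    ∃ L : LocalSystem E (E.src β), ∀ z, L.toEquiv z ∈ C ↔ z ∉ P := by
  have := E.countable_sedge
  obtain ⟨e, he⟩ := hP.compl.exists_equiv_mem_iff hC
  refine ⟨⟨e, fun z => ?_⟩, he⟩
  by_cases hz : z ∈ P
  · rw [hPβ z hz, hβ]
    exact (e z).2.isLt
  · rw [hC0 _ ((he z).2 hz)]
    exact E.weight_pos _

theorem nonempty_localSystem (v : E.Vert) : Nonempty (LocalSystem E v) := by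
  rcases (E.src ⁻¹' {v}).eq_empty_or_nonempty with hv | hv
  · have hempty : IsEmpty {α // E.src α = v} := Set.isEmpty_coe_sort.2 hv
    have hweight : E.vertWeight v = 0 := by
      rw [vertWeight, out, Set.Finite.toFinset_eq_empty.2 hv, Finset.sup_empty, Nat.bot_eq_zero]
    have : IsEmpty (Fin (E.vertWeight v)) := hweight ▸ Fin.isEmpty
    exact ⟨⟨Equiv.equivOfIsEmpty _ _, isEmptyElim⟩⟩
  · obtain ⟨β, rfl, hβ⟩ := exists_weight_eq_vertWeight hv
    obtain ⟨P, hPβ, hP⟩ := exists_isMoiety_subset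
      (infinite_fst_eq (Y := ℕ) (⟨β, rfl⟩ : {α // E.src α = E.src β}))
    obtain ⟨C, hC0, hC⟩ := exists_isMoiety_subset
      (infinite_snd_eq (X := ℕ) (⟨0, vertWeight_src_pos β⟩ : Fin (E.vertWeight (E.src β))))
    exact ⟨(exists_localSystem_mem_iff hβ hPβ hP
      (fun c hc => congrArg Fin.val (hC0 hc)) hC).choose⟩

theorem nonempty_branchingSystem : Nonempty (BranchingSystem E) :=
  ⟨fun v => (nonempty_localSystem v).some⟩

end LocalSystems

section Separation

/-- The word consisting of the edge `α_1`. -/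
def firstEdge {E : WeightedGraph.{u, v}} (α : E.SEdge) : FreeSemigroup E.Gen :=
  .of (.edge α ⟨0, E.weight_pos α⟩)

namespace BranchingSystem

variable {E : WeightedGraph.{u, v}} (S S' : BranchingSystem E)

/-- The labels of the points over `v` in the range of the partial injection given by `x`. -/
def rangeOver (x : FreeSemigroup E.Gen) (v : E.Vert) : Set ℕ := {t | ∃ p, (v, t) ∈ S.wordMap x p}

/-- The copy of `S.rangeOver x v` in the slice `i = 0` of `ℕ × Fin (E.vertWeight v)`. Under
`(S v).toEquiv` it corresponds to the points reached by `x` followed by an edge `α_1`. -/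
def rangeSlice (x : FreeSemigroup E.Gen) (v : E.Vert) : Set (ℕ × Fin (E.vertWeight v)) :=
  {c | (c.2 : ℕ) = 0 ∧ c.1 ∈ S.rangeOver x v}

variable {S S'}

theorem rangeOver_congr {x : FreeSemigroup E.Gen} (h : S.wordMap x = S'.wordMap x) (v : E.Vert) :
    S.rangeOver x v = S'.rangeOver x v := by
  rw [rangeOver, rangeOver, h]

theorem rangeSlice_congr {x : FreeSemigroup E.Gen} (h : S.wordMap x = S'.wordMap x) (v : E.Vert) :
    S.rangeSlice x v = S'.rangeSlice x v := by
  rw [rangeSlice, rangeSlice, rangeOver_congr h]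

variable (S)

theorem rangeOver_vert (v : E.Vert) : S.rangeOver (.of (.vert v)) v = Set.univ := by
  refine Set.eq_univ_of_forall fun t => ⟨(v, t), ?_⟩
  rw [wordMap_of]
  exact mem_vertMap.2 ⟨rfl, rfl⟩

theorem image_rangeOver_eq_rangeSlice {x : FreeSemigroup E.Gen} {v : E.Vert}
    (hv : 0 < E.vertWeight v) :
    (fun t => (t, ⟨0, hv⟩)) '' S.rangeOver x v = S.rangeSlice x v := by
  ext ⟨t, i⟩
  constructor
  · rintro ⟨t, ht, ⟨⟩⟩
    exact ⟨rfl, ht⟩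
  · rintro ⟨hi, ht⟩
    exact ⟨t, ht, Prod.ext rfl (Fin.ext hi.symm)⟩

theorem mem_rangeOver_mul_firstEdge {x : FreeSemigroup E.Gen} {α : E.SEdge} {t : ℕ} :
    t ∈ S.rangeOver (x * firstEdge α) (E.rng α) ↔
      (S (E.src α)).toEquiv (⟨α, rfl⟩, t) ∈ S.rangeSlice x (E.src α) := by
  have hmap : S.wordMap (x * firstEdge α) = S.wordMap x * S.edgeMap α 0 := by
    rw [map_mul, firstEdge, wordMap_of, genMap]
  simp only [rangeOver, rangeSlice, Set.mem_ofPred_eq, hmap, mem_mul, mem_edgeMap]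
  constructor
  · rintro ⟨p, ⟨u, s⟩, hp, -, hu, hi, hz⟩
    obtain rfl : E.src α = u := hu
    rw [hz]
    exact ⟨rfl, p, hp⟩
  · rintro ⟨hi, p, hp⟩
    exact ⟨p, _, hp, rfl, rfl, vertWeight_src_pos α, Prod.ext rfl (Fin.ext hi)⟩

theorem mul_symm_wordMap_ne_bot_iff {x y : FreeSemigroup E.Gen} {α : E.SEdge} :
    S.wordMap (x * firstEdge α) * (S.wordMap y).symm ≠ ⊥ ↔ ∃ t ∈ S.rangeOver y (E.rng α),
      (S (E.src α)).toEquiv (⟨α, rfl⟩, t) ∈ S.rangeSlice x (E.src α) := by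
  simp only [← mem_rangeOver_mul_firstEdge, ne_bot_iff_exists_mem]
  constructor
  · rintro ⟨p, r, h⟩
    obtain ⟨⟨u, t⟩, hpq, hqr⟩ := mem_mul.1 h
    obtain ⟨q, -, hα⟩ := mem_mul.1 ((map_mul S.wordMap x _) ▸ hpq)
    rw [firstEdge, wordMap_of, genMap, mem_edgeMap] at hα
    obtain rfl : u = E.rng α := hα.target
    exact ⟨t, ⟨r, (PEquiv.mem_iff_mem _).1 hqr⟩, p, hpq⟩
  · rintro ⟨t, ⟨r, hr⟩, p, hp⟩
    exact ⟨p, r, mem_mul.2 ⟨_, hp, (PEquiv.mem_iff_mem _).2 hr⟩⟩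

theorem exists_wordMap_eq_symm (y : FreeSemigroup E.Gen) :
    ∃ z, ∀ S : BranchingSystem E, S.wordMap z = (S.wordMap y).symm := by
  induction y using FreeSemigroup.recOnMul with
  | ih1 g =>
    cases g with
    | vert v => exact ⟨.of (.vert v), fun S => by simp only [wordMap_of, genMap, vertMap_symm]⟩
    | edge α i => exact ⟨.of (.ghost α i), fun S => by simp only [wordMap_of, genMap]⟩
    | ghost α i =>
      exact ⟨.of (.edge α i), fun S => by simp only [wordMap_of, genMap, PEquiv.symm_symm]⟩
  | ih2 g y hg hy =>
    obtain ⟨zg, hzg⟩ := hg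
    obtain ⟨zy, hzy⟩ := hy
    exact ⟨zy * zg, fun S => by rw [map_mul, map_mul, symm_mul, hzg, hzy]⟩

end BranchingSystem

open BranchingSystem

variable {E : WeightedGraph.{u, v}}

/-- The action of the word `x` does not depend on the local system at `v`. -/
def IsIndependentOf (x : FreeSemigroup E.Gen) (v : E.Vert) : Prop :=
  ∀ S S' : BranchingSystem E, (∀ u ≠ v, S u = S' u) → S.wordMap x = S'.wordMap x

theorem hasSeparatingWord_of_isMoiety (S : BranchingSystem E) {β : E.SEdge}
    (hβ : E.weight β = E.vertWeight (E.src β)) {x y : FreeSemigroup E.Gen}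
    (hx : IsIndependentOf x (E.src β)) (hy : IsIndependentOf y (E.src β))
    (hslice : IsMoiety (S.rangeSlice x (E.src β)))
    (hrange : IsMoiety (Prod.mk (⟨β, rfl⟩ : {α // E.src α = E.src β}) ''
      S.rangeOver y (E.rng β))) :
    E.HasSeparatingWord := by
  classical
  set C := S.rangeSlice x (E.src β)
  set P := Prod.mk (⟨β, rfl⟩ : {α // E.src α = E.src β}) '' S.rangeOver y (E.rng β)
  have hPβ : ∀ p ∈ P, p.1 = ⟨β, rfl⟩ := by rintro _ ⟨t, -, rfl⟩; rfl
  have hC0 : ∀ c ∈ C, (c.2 : ℕ) = 0 := fun c hc => hc.1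
  obtain ⟨z, hz⟩ := exists_wordMap_eq_symm y
  let S' (L : LocalSystem E (E.src β)) : BranchingSystem E := Function.update S (E.src β) L
  have hS' (L) : ∀ u ≠ E.src β, S' L u = S u := fun u hu => Function.update_of_ne hu L S
  have hiff (L) : (S' L).wordMap (x * firstEdge β * z) ≠ ⊥ ↔ ∃ p ∈ P, L.toEquiv p ∈ C := by
    rw [map_mul, hz, mul_symm_wordMap_ne_bot_iff, rangeOver_congr (hy _ _ (hS' L)),
      rangeSlice_congr (hx _ _ (hS' L)), Set.exists_mem_image, show S' L (E.src β) = L from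
        Function.update_self ..]
  obtain ⟨c, hc⟩ := hslice.1.nonempty
  obtain ⟨L, hL⟩ := exists_localSystem_mem_iff hβ hPβ hrange hC0 hslice
  obtain ⟨L', hL'⟩ := exists_localSystem_mem_iff hβ hPβ hrange (C := C \ {c})
    (fun _ hc => hC0 _ hc.1) (hslice.sdiff_singleton c)
  refine ⟨x * firstEdge β * z, S' L, S' L', ?_, ?_⟩
  · exact not_not.1 fun h => let ⟨p, hp, hpC⟩ := (hiff L).1 h; (hL p).1 hpC hp
  · obtain ⟨p, rfl⟩ := L'.toEquiv.surjective c
    exact (hiff L').2 ⟨p, not_not.1 fun hp => ((hL' p).2 hp).2 rfl, hc⟩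

end Separation

section PathWords

open BranchingSystem

/-- The words `u α_1 β_1 ⋯ γ_1` given by the paths from a weighted vertex `u` to `v` all of whose
vertices, except possibly `v`, lie outside `A`. -/
inductive IsPathWord {E : WeightedGraph.{u, v}} (A : Set E.Vert) :
    FreeSemigroup E.Gen → E.Vert → Prop
  | nil {w} (hw : w ∈ E.weightedVerts) : IsPathWord A (.of (.vert w)) w
  | snoc {x α} (hx : IsPathWord A x (E.src α)) (hα : E.src α ∉ A) :
      IsPathWord A (x * firstEdge α) (E.rng α)

variable {E : WeightedGraph.{u, v}} {A B : Set E.Vert} {x y : FreeSemigroup E.Gen} {v u : E.Vert}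

theorem IsPathWord.anti (hx : IsPathWord A x v) (h : B ⊆ A) : IsPathWord B x v := by
  induction hx with
  | nil hv => exact .nil hv
  | snoc _ hα ih => exact .snoc ih fun hαB => hα (h hαB)

theorem IsPathWord.mem_weightForest (hx : IsPathWord A x v) : v ∈ E.weightForest := by
  induction hx with
  | nil hv => exact Set.mem_biUnion hv Relation.ReflTransGen.refl
  | @snoc _ α _ _ ih =>
    obtain ⟨u, hu, hreach⟩ := Set.mem_iUnion₂.1 ih
    exact Set.mem_biUnion hu (Relation.ReflTransGen.tail hreach ⟨α, rfl, rfl⟩)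

theorem exists_isPathWord_mem (hv : v ∈ E.weightForest) (hvA : v ∈ A) :
    ∃ a ∈ A, ∃ x, IsPathWord A x a := by
  obtain ⟨u, hu, hreach : E.Reaches u v⟩ := Set.mem_iUnion₂.1 hv
  suffices h : (∃ x, IsPathWord A x v) ∨ ∃ a ∈ A, ∃ x, IsPathWord A x a from
    h.elim (fun hx => ⟨v, hvA, hx⟩) id
  clear hv hvA
  induction hreach with
  | refl => exact .inl ⟨_, .nil hu⟩
  | tail _ hstep ih =>
    obtain ⟨α, rfl, rfl⟩ := hstep
    refine ih.elim (fun ⟨x, hx⟩ => ?_) .inr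
    by_cases hα : E.src α ∈ A
    · exact .inr ⟨_, hα, x, hx⟩
    · exact .inl ⟨_, hx.snoc hα⟩

theorem isIndependentOf_vert (w : E.Vert) : IsIndependentOf (.of (.vert w)) u := fun S S' _ => by
  rw [wordMap_of, wordMap_of, genMap, genMap]

theorem IsPathWord.isIndependentOf (hx : IsPathWord A x v) (hu : u ∈ A) : IsIndependentOf x u := by
  induction hx with
  | nil => exact isIndependentOf_vert _
  | @snoc x α _ hα ih =>
    intro S S' h
    have hedge : S.edgeMap α 0 = S'.edgeMap α 0 :=
      edgeMap_congr (h _ fun hαu => hα (by rwa [hαu])) 0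
    rw [map_mul, map_mul, ih S S' h, firstEdge, wordMap_of, wordMap_of, genMap, genMap, hedge]

theorem eq_of_src_notMem_branchingVerts {α β : E.SEdge} (hα : E.src α ∉ E.branchingVerts)
    (h : E.src β = E.src α) : β = α :=
  Set.not_nontrivial_iff.1 hα h rfl

theorem isMoiety_rangeOver_mul_firstEdge (S : BranchingSystem E) {α : E.SEdge}
    (hα : E.src α ∉ E.branchingVerts) (hx : IsMoiety (S.rangeSlice x (E.src α))) :
    IsMoiety (S.rangeOver (x * firstEdge α) (E.rng α)) := by
  have hsurj : Function.Surjective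
      fun t => (S (E.src α)).toEquiv ((⟨α, rfl⟩ : {α' // E.src α' = E.src α}), t) := by
    refine (S (E.src α)).toEquiv.surjective.comp fun ⟨⟨β, hβ⟩, t⟩ => ⟨t, ?_⟩
    exact Prod.ext (Subtype.ext (eq_of_src_notMem_branchingVerts hα hβ).symm) rfl
  convert hx.preimage_of_surjective hsurj using 1
  exact Set.ext fun t => S.mem_rangeOver_mul_firstEdge

/-- A weighted vertex has at least two slices, so even a full slice is a moiety. Along the path the
moiety is then transported from one vertex to the next. -/
theorem IsPathWord.isMoiety_rangeSlice (S : BranchingSystem E) (hA : E.branchingVerts ⊆ A)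
    (hx : IsPathWord A x v) (hv : 0 < E.vertWeight v) : IsMoiety (S.rangeSlice x v) := by
  induction hx with
  | @nil w hw =>
    have : Nontrivial (Fin (E.vertWeight w)) := Fin.nontrivial_iff_two_le.2 hw
    convert isMoiety_snd_eq (X := ℕ) (⟨0, hv⟩ : Fin (E.vertWeight w)) using 1
    ext c
    simp only [rangeSlice, rangeOver_vert, Set.mem_univ, and_true, Set.mem_ofPred_eq, Fin.ext_iff]
  | @snoc x α _ hα ih =>
    rw [← S.image_rangeOver_eq_rangeSlice hv]
    exact (isMoiety_rangeOver_mul_firstEdge S (fun h => hα (hA h))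
      (ih (vertWeight_src_pos α))).image_of_injective (Prod.mk_left_injective _)

end PathWords

section ForestCondition

open BranchingSystem

variable {E : WeightedGraph.{u, v}}

theorem hasSeparatingWord_of_branching {v : E.Vert} (hv : v ∈ E.weightForest)
    (hvE : v ∈ E.branchingVerts) : E.HasSeparatingWord := by
  obtain ⟨a, haE, x, hx⟩ := exists_isPathWord_mem hv hvE
  obtain ⟨β, rfl, hβ⟩ := exists_weight_eq_vertWeight haE.nonempty
  obtain ⟨S⟩ := nonempty_branchingSystem (E := E)
  have : Nontrivial {α // E.src α = E.src β} := Set.nontrivial_coe_sort.2 haE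
  refine hasSeparatingWord_of_isMoiety S hβ (hx.isIndependentOf haE)
    (isIndependentOf_vert (E.rng β)) (hx.isMoiety_rangeSlice S subset_rfl (vertWeight_src_pos β)) ?_
  convert isMoiety_fst_eq (Y := ℕ) (⟨β, rfl⟩ : {α // E.src α = E.src β}) using 1
  ext ⟨γ, t⟩
  simp [rangeOver_vert, eq_comm]

variable {α β : E.SEdge}

/-- Since the path of `y` avoids the source of `β`, the word `y α_1` is independent of the local
system there. This holds even if the path from the weight forest to the source of `β` uses `α`. -/
theorem hasSeparatingWord_of_isPathWord (hW : Disjoint E.weightForest E.branchingVerts)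
    (hβW : E.src β ∈ E.weightForest) (hα : E.src α ∉ E.branchingVerts) (hne : E.src α ≠ E.src β)
    (hr : E.rng α = E.rng β) {y : FreeSemigroup E.Gen}
    (hy : IsPathWord ({E.src α, E.src β} ∪ E.branchingVerts) y (E.src α)) :
    E.HasSeparatingWord := by
  obtain ⟨S⟩ := nonempty_branchingSystem (E := E)
  have hβ : E.src β ∉ E.branchingVerts := hW.notMem_of_mem_left hβW
  obtain ⟨γ, hγ, hweight⟩ := exists_weight_eq_vertWeight ⟨β, rfl⟩
  obtain rfl : β = γ := (eq_of_src_notMem_branchingVerts hβ hγ).symm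
  have hyβ : IsPathWord ({E.src β} ∪ E.branchingVerts) y (E.src α) := hy.anti (by gcongr; simp)
  have hyα := hyβ.snoc (by simp [hne, hα])
  obtain ⟨a, ha, x, hx⟩ := exists_isPathWord_mem (A := {E.src β} ∪ E.branchingVerts) hβW (.inl rfl)
  obtain rfl : a = E.src β :=
    ha.resolve_right (hW.notMem_of_mem_left hx.mem_weightForest)
  refine hasSeparatingWord_of_isMoiety S hweight (hx.isIndependentOf ha) (hyα.isIndependentOf ha)
    (hx.isMoiety_rangeSlice S Set.subset_union_right (vertWeight_src_pos β)) ?_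
  rw [← hr]
  exact (isMoiety_rangeOver_mul_firstEdge S hα (hy.isMoiety_rangeSlice S Set.subset_union_right
    (vertWeight_src_pos α))).image_of_injective (Prod.mk_right_injective _)

theorem hasSeparatingWord_of_rng_eq (hW : Disjoint E.weightForest E.branchingVerts)
    (hα : E.src α ∈ E.weightForest) (hβ : E.src β ∈ E.weightForest) (hne : α ≠ β)
    (hr : E.rng α = E.rng β) : E.HasSeparatingWord := by
  have hα' := hW.notMem_of_mem_left hα
  have hβ' := hW.notMem_of_mem_left hβ
  have hsrc : E.src α ≠ E.src β := fun h => hne (eq_of_src_notMem_branchingVerts hβ' h)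
  obtain ⟨a, ha, y, hy⟩ := exists_isPathWord_mem
    (A := {E.src α, E.src β} ∪ E.branchingVerts) hα (.inl (.inl rfl))
  rcases ha.resolve_right (hW.notMem_of_mem_left hy.mem_weightForest) with rfl | rfl
  · exact hasSeparatingWord_of_isPathWord hW hβ hα' hsrc hr hy
  · rw [Set.pair_comm] at hy
    exact hasSeparatingWord_of_isPathWord hW hα hβ' hsrc.symm hr.symm hy

theorem hasSeparatingWord_of_not_forestCondition (h : ¬ E.ForestCondition) :
    E.HasSeparatingWord := by
  by_cases hW : Disjoint E.weightForest E.branchingVerts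
  · simp only [ForestCondition, not_forall] at h
    obtain ⟨v, hv, hcard⟩ := h
    rw [Set.encard_le_one_iff_subsingleton, Set.encard_le_one_iff_subsingleton] at hcard
    have hout : (E.src ⁻¹' {v}).Subsingleton :=
      Set.not_nontrivial_iff.1 (hW.notMem_of_mem_left hv)
    obtain ⟨α, ⟨hα, hαW⟩, β, ⟨hβ, hβW⟩, hne⟩ :=
      Set.not_subsingleton_iff.1 fun hin => hcard ⟨hout, hin⟩
    exact hasSeparatingWord_of_rng_eq hW hαW hβW hne (hα.trans hβ.symm)
  · obtain ⟨v, hv, hvE⟩ := Set.not_disjoint_iff.1 hW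
    exact hasSeparatingWord_of_branching hv hvE

end ForestCondition

end WeightedGraph

theorem mainTheorem7 (E : WeightedGraph.{u, v}) (hE : E.IsIrreducible) (R : Type w) [Ring R] :
    ¬ E.IsGradedSimple R ∧
      (Nontrivial R → ∃ J : TwoSidedIdeal (WeightedGraph.LeavittPathRing R E),
        E.IsGradedIdeal J ∧ E.IsProperIdeal J) := by
  have key (_ : Nontrivial R) : ∃ J : TwoSidedIdeal (WeightedGraph.LeavittPathRing R E),
      E.IsGradedIdeal J ∧ E.IsProperIdeal J :=
    WeightedGraph.exists_properGradedIdeal_of_hasSeparatingWord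
      (WeightedGraph.hasSeparatingWord_of_not_forestCondition fun h => hE.2 ⟨hE.1, h⟩)
  refine ⟨fun h => ?_, key⟩
  rcases subsingleton_or_nontrivial R with hR | hR
  · obtain ⟨⟨a, b, hab⟩, -⟩ := h
    refine hab ?_
    rw [← one_smul R (a * b), Subsingleton.elim (1 : R) 0, zero_smul]
  · exact h.2 (key hR)
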